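/- \textbf{Setting.} Let $Var$ be a countably infinite set of quantum variables, each of type $\mathbf{Boolean}$ (state space $\mathcal H_q=\mathbb C^2$ with basis $|0\rangle,|1\rangle$) or $\mathbf{integer}$ (state space $\mathcal H_q=\ell^2(\mathbb Z)$ with basis $|n\rangle$, $n\in\mathbb Z$). A register $\overline q=q_1,\dots,q_n$ is a finite sequence of distinct variables, with $\mathcal H_{\overline q}=\bigotimes_{i=1}^n\mathcal H_{q_i}$. The space $\mathcal H_{\rm all}=\bigotimes_{q}\mathcal H_q$ is the Hilbert space with orthonormal basis a nonempty family $\mathcal B$ of formal products $\bigotimes_q|x_q\rangle$ of basis vectors that is closed under changing finitely many factors (for instance the products with $x_q=0$ for all but finitely many $q$, or all products). An operator $A$ on $\mathcal H_{\overline q}$ is identified with its cylinder extension $A\otimes I$ on $\mathcal H_{\rm all}$. $\mathcal D^-$ is the set of partial density operators on $\mathcal H_{\rm all}$ (positive, of trace at most $1$), and $\sqsubseteq$ is the Löwner order ($A\sqsubseteq B$ iff $B-A$ is positive). A measurement on $\mathcal H_{\overline q}$ is a family $M=\{M_m\}$ of bounded operators, possibly infinite, with $\sum_m M_m^\dagger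 M_m=I$ (strongly). \textbf{Programs.} $S::=\mathbf{skip}\mid q:=0\mid\overline q:=U\overline q\mid S_1;S_2\mid\mathbf{measure}\ M[\overline q]:\overline S\mid\mathbf{while}\ M[\overline q]=1\ \mathbf{do}\ S$, where $U$ is an operator on $\mathcal H_{\overline q}$ with $U^\dagger U=I$, $\overline S=\{S_m\}$ has one program for each outcome of $M$, and $M=\{M_0,M_1\}$ in a loop. $E$ is the empty program, and $E;S=S$. \textbf{Transitions.} $\langle\mathbf{skip},\rho\rangle\to\langle E,\rho\rangle$; $\langle q:=0,\rho\rangle\to\langle E,\sum_k|0\rangle_q\langle k|\rho|k\rangle_q\langle 0|\rangle$, with $k$ ranging over the basis labels of $\mathcal H_q$; $\langle\overline q:=U\overline q,\rho\rangle\to\langle E,U\rho U^\dagger\rangle$; if $\langle S_1,\rho\rangle\to\langle S_1',\rho'\rangle$ then $\langle S_1;S_2,\rho\rangle\to\langle S_1';S_2,\rho'\rangle$; $\langle\mathbf{measure}\ M[\overline q]:\overline S,\rho\rangle\to\langle S_m,M_m\rho M_m^\dagger\rangle$ for each outcome $m$; and, for $W=\mathbf{while}\ M[\overline q]=1\ \mathbf{do}\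 S$, $\langle W,\rho\rangle\to\langle E,M_0\rho M_0^\dagger\rangle$ and $\langle W,\rho\rangle\to\langle S;W,M_1\rho M_1^\dagger\rangle$. \textbf{Semantics.} $[|S|](\rho)=\sum\{|\rho':\langle S,\rho\rangle\to^*\langle E,\rho'\rangle|\}$, the sum over a multiset: each $\rho'$ is counted once for every computation leading to it, computations with different measurement outcomes being different. Infinite sums of operators are unconditional sums in operator norm. \textbf{Unfoldings.} For a program $\Omega$, put $W^0=\Omega$ and $W^{n+1}=\mathbf{measure}\ M[\overline q]:\{S_0=\mathbf{skip},\ S_1=S;W^n\}$. Put $\mathcal E_i(\rho)=M_i\rho M_i^\dagger$. \textbf{Proposition.} For every program $S$ and $\rho\in\mathcal D^-$ the sum defining $[|S|](\rho)$ converges and $[|S|](\rho)\in\mathcal D^-$. Moreover, for every $\rho\in\mathcal D^-$: \begin{enumerate} \item $[|\mathbf{skip}|](\rho)=\rho$. \item If $q$ has type $\mathbf{Boolean}$, then $[|q:=0|](\rho)=|0\rangle_q\langle0|\rho|0\rangle_q\langle0|+|0\rangle_q\langle1|\rho|1\rangle_q\langle0|$; if $q$ has type $\mathbf{integer}$, then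 $[|q:=0|](\rho)=\sum_{n\in\mathbb Z}|0\rangle_q\langle n|\rho|n\rangle_q\langle0|$. \item $[|\overline q:=U\overline q|](\rho)=U\rho U^\dagger$. \item $[|S_1;S_2|](\rho)=[|S_2|]([|S_1|](\rho))$. \item $[|\mathbf{measure}\ M[\overline q]:\overline S|](\rho)=\sum_m[|S_m|](M_m\rho M_m^\dagger)$. \item For $W=\mathbf{while}\ M[\overline q]=1\ \mathbf{do}\ S$ and every program $\Omega$ with $[|\Omega|](\sigma)=0$ for all $\sigma\in\mathcal D^-$, the operator $[|W|](\rho)$ is the least upper bound of $\{[|W^n|](\rho):n\ge0\}$ with respect to $\sqsubseteq$; and $[|W|](\rho)=\sum_{k=0}^\infty[\mathcal E_0\circ([|S|]\circ\mathcal E_1)^k](\rho)$. \item For every variable $q$, the program $\mathbf{while}\ M_{\rm trivial}[q]=1\ \mathbf{do}\ \mathbf{skip}$ with $M_{\rm trivial}=\{M_0=0,M_1=I\}$ has $[|\cdot|](\rho)=0$, so it may be taken for $\Omega$. \end{enumerate} All the infinite sums in 2, 5 and 6 converge. -/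

import Mathlib

open scoped InnerProductSpace

namespace QWhile

noncomputable section

/-! ## Hilbert spaces and partial density operators -/

/-- The Hilbert space `ℓ²(I)` of square summable families, with computational basis indexed
by `I`. -/
abbrev L2 (I : Type*) : Type _ := lp (fun _ : I => ℂ) 2

/-- The computational basis vector `|a⟩`. -/
def ket {I : Type*} (a : I) : L2 I :=
  haveI := Classical.decEq I
  lp.single 2 a (1 : ℂ)

/-- The operator `|a⟩⟨b|`. -/
def ketbra {I : Type*} (a b : I) : L2 I →L[ℂ] L2 I :=
  InnerProductSpace.rankOne ℂ (ket a) (ket b)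

section Operators

variable {H : Type*} [NormedAddCommGroup H] [InnerProductSpace ℂ H] [CompleteSpace H]

/-- `T ρ T†`. -/
def conj (T ρ : H →L[ℂ] H) : H →L[ℂ] H :=
  T ∘L ρ ∘L ContinuousLinearMap.adjoint T

/-- Partial density operators: positive operators of trace at most one, where the trace is
`∑ᵢ ⟨ψᵢ|ρ|ψᵢ⟩` for an orthonormal basis `(ψᵢ)`. -/
def IsPartialDensity (ρ : H →L[ℂ] H) : Prop :=
  ρ.IsPositive ∧ ∀ (s : Set H) (b : HilbertBasis s ℂ H),
    Summable (fun i => ⟪b i, ρ (b i)⟫_ℂ) ∧ (∑' i, ⟪b i, ρ (b i)⟫_ℂ).re ≤ 1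

/-- A quantum measurement with outcome set `ι`: operators `M_m` with `∑ₘ Mₘ† Mₘ = I`. The
outcome set may be infinite; the sum converges in the strong operator topology. -/
structure Measurement (ι : Type) (H : Type*) [NormedAddCommGroup H] [InnerProductSpace ℂ H]
    [CompleteSpace H] where
  op : ι → H →L[ℂ] H
  complete : ∀ ψ : H, HasSum (fun m => ContinuousLinearMap.adjoint (op m) (op m ψ)) ψ

/-- The trivial yes-no measurement `M₀ = 0`, `M₁ = I`. -/
def Measurement.trivial : Measurement (Fin 2) H where
  op := ![0, ContinuousLinearMap.id ℂ H]
  complete ψ := by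
    have h := hasSum_fintype (fun m : Fin 2 => ContinuousLinearMap.adjoint
      ((![0, ContinuousLinearMap.id ℂ H] : Fin 2 → H →L[ℂ] H) m)
      ((![0, ContinuousLinearMap.id ℂ H] : Fin 2 → H →L[ℂ] H) m ψ))
    have e : ContinuousLinearMap.adjoint (ContinuousLinearMap.id ℂ H)
        = ContinuousLinearMap.id ℂ H :=
      star_one (H →L[ℂ] H)
    simpa [Fin.sum_univ_two, e] using h

end Operators

/-! ## Quantum variables, registers and state spaces -/

/-- The two basic types of quantum variables. -/
inductive QType
  | boolean
  | integer

/-- The labels of the computational basis of the Hilbert space denoted by a type. -/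
def Idx : QType → Type
  | .boolean => Fin 2
  | .integer => ℤ

/-- The label of the basis state `|0⟩`. -/
def zeroIdx : (t : QType) → Idx t
  | .boolean => (0 : Fin 2)
  | .integer => (0 : ℤ)

/-- The label of `|i⟩`, `i = 0, 1`, of a variable of type `Boolean`. -/
def boolIdx {t : QType} (h : t = .boolean) (i : Fin 2) : Idx t :=
  cast (congrArg Idx h.symm) i

/-- The label of `|n⟩`, `n ∈ ℤ`, of a variable of type `integer`. -/
def intIdx {t : QType} (h : t = .integer) (n : ℤ) : Idx t :=
  cast (congrArg Idx h.symm) n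

/-- A quantum register: a finite sequence of distinct quantum variables. -/
abbrev Register (Var : Type) (n : ℕ) : Type := Fin n ↪ Var

/-- The register consisting of one variable. -/
def single {Var : Type} (q : Var) : Register Var 1 where
  toFun _ := q
  inj' _ _ _ := Subsingleton.elim _ _

/-- The labels of the product basis of a register. -/
abbrev RegIdx {Var : Type} (ty : Var → QType) {n : ℕ} (r : Register Var n) : Type :=
  (i : Fin n) → Idx (ty (r i))

/-- The state space of a register: the tensor product of the state spaces of its variables,
that is, the Hilbert space with orthonormal basis the products of basis vectors. -/
abbrev RegSpace {Var : Type} (ty : Var → QType) {n : ℕ} (r : Register Var n) : Type :=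
  L2 (RegIdx ty r)

/-- Assignments of a basis label to every variable; `x` stands for `⨂_q |x q⟩`. -/
abbrev Assignment {Var : Type} (ty : Var → QType) : Type := (q : Var) → Idx (ty q)

/-- A family of product basis vectors `⨂_q |x q⟩` from which the tensor product of the state
spaces of all variables is formed: it is nonempty and closed under changing finitely many
coordinates. -/
structure ProductBasis {Var : Type} (ty : Var → QType) where
  carrier : Set (Assignment ty)
  nonempty : carrier.Nonempty
  closed : ∀ x ∈ carrier, ∀ y : Assignment ty, {q | y q ≠ x q}.Finite → y ∈ carrier

/-- All product basis vectors. -/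
def ProductBasis.all {Var : Type} (ty : Var → QType) : ProductBasis ty where
  carrier := Set.univ
  nonempty := ⟨fun q => zeroIdx (ty q), trivial⟩
  closed _ _ _ _ := trivial

/-- The product basis vectors that differ from `⨂_q |0⟩` in finitely many factors only (a
countable family when there are countably many variables). -/
def ProductBasis.ground {Var : Type} (ty : Var → QType) : ProductBasis ty where
  carrier := {x | {q | x q ≠ zeroIdx (ty q)}.Finite}
  nonempty := ⟨fun q => zeroIdx (ty q), by simp⟩
  closed x hx y hy := by
    refine (hx.union hy).subset fun q hq => ?_
    by_cases h : y q = x q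
    · exact Or.inl (fun h' => hq (h.trans h'))
    · exact Or.inr h

variable {Var : Type} {ty : Var → QType} {n : ℕ}

/-- The state space of all quantum variables. -/
abbrev AllSpace (B : ProductBasis ty) : Type := L2 B.carrier

/-- Bounded operators on the state space of all quantum variables. -/
abbrev AllOp (B : ProductBasis ty) : Type := AllSpace B →L[ℂ] AllSpace B

/-! ## Cylinder extension of an operator on a register -/

open Classical in
/-- The assignment `x` with the values on the register `r` replaced by `a`. -/
def updReg (r : Register Var n) (x : Assignment ty) (a : RegIdx ty r) : Assignment ty :=
  fun q => if h : ∃ i, r i = q then h.choose_spec ▸ a h.choose else x q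

/-- The values of the assignment `x` on the register `r`. -/
def readReg (r : Register Var n) (x : Assignment ty) : RegIdx ty r := fun i => x (r i)

theorem updReg_apply (r : Register Var n) (x : Assignment ty) (a : RegIdx ty r) (i : Fin n) :
    updReg r x a (r i) = a i := by
  have h : ∃ j, r j = r i := ⟨i, rfl⟩
  unfold updReg
  rw [dif_pos h]
  have key : ∀ (j : Fin n) (e : r j = r i), (e ▸ a j : Idx (ty (r i))) = a i := by
    intro j e
    obtain rfl := r.injective e
    rfl
  exact key _ h.choose_spec

theorem updReg_of_notMem (r : Register Var n) (x : Assignment ty) (a : RegIdx ty r) {q : Var}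
    (hq : ¬ ∃ i, r i = q) : updReg r x a q = x q := by
  unfold updReg
  rw [dif_neg hq]

theorem readReg_updReg (r : Register Var n) (x : Assignment ty) (a : RegIdx ty r) :
    readReg r (updReg r x a) = a :=
  funext fun i => updReg_apply r x a i

theorem updReg_updReg (r : Register Var n) (x : Assignment ty) (a b : RegIdx ty r) :
    updReg r (updReg r x a) b = updReg r x b := by
  funext q
  by_cases hq : ∃ i, r i = q
  · obtain ⟨i, rfl⟩ := hq
    rw [updReg_apply, updReg_apply]
  · simp only [updReg_of_notMem r _ _ hq]

theorem updReg_readReg (r : Register Var n) (x : Assignment ty) :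
    updReg r x (readReg r x) = x := by
  funext q
  by_cases hq : ∃ i, r i = q
  · obtain ⟨i, rfl⟩ := hq
    rw [updReg_apply]
    rfl
  · rw [updReg_of_notMem r _ _ hq]

/-- `updReg` on the chosen product basis. -/
def upd (B : ProductBasis ty) (r : Register Var n) (x : B.carrier) (a : RegIdx ty r) :
    B.carrier :=
  ⟨updReg r x.1 a, B.closed x.1 x.2 _ ((Set.finite_range r).subset fun q hq => by
    by_contra h
    exact hq (updReg_of_notMem r x.1 a h))⟩

theorem upd_injective (B : ProductBasis ty) (r : Register Var n) (x : B.carrier) :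
    Function.Injective (upd B r x) := fun a b h => by
  have h' : updReg r x.1 a = updReg r x.1 b := congrArg Subtype.val h
  rw [← readReg_updReg r x.1 a, h', readReg_updReg]

/-- The ground labels of a register. -/
def zeroReg (ty : Var → QType) (r : Register Var n) : RegIdx ty r := fun i => zeroIdx (ty (r i))

/-- Product basis vectors of the environment of `r`, represented by the basis vectors in which
the variables of `r` are in the ground state. -/
def Env (B : ProductBasis ty) (r : Register Var n) : Type :=
  {x : B.carrier // readReg r x.1 = zeroReg ty r}

/-- A basis vector is a basis vector of the environment together with one of the register. -/
def splitEquiv (B : ProductBasis ty) (r : Register Var n) :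
    Env B r × RegIdx ty r ≃ B.carrier where
  toFun p := upd B r p.1.1 p.2
  invFun x := (⟨upd B r x (zeroReg ty r), readReg_updReg r x.1 _⟩, readReg r x.1)
  left_inv := by
    rintro ⟨⟨x, hx⟩, a⟩
    refine Prod.ext (Subtype.ext (Subtype.ext ?_)) (readReg_updReg r x.1 a)
    change updReg r (updReg r x.1 a) (zeroReg ty r) = x.1
    rw [updReg_updReg, ← hx, updReg_readReg]
  right_inv x := by
    refine Subtype.ext ?_
    change updReg r (updReg r x.1 (zeroReg ty r)) (readReg r x.1) = x.1
    rw [updReg_updReg, updReg_readReg]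

theorem memLp_iff {I : Type*} (f : I → ℂ) :
    Memℓp f 2 ↔ Summable (fun i => ‖f i‖ ^ 2) := by
  rw [memℓp_gen_iff (by norm_num)]
  norm_num

theorem hasSum_normSq {I : Type*} (f : L2 I) : HasSum (fun i => ‖f i‖ ^ 2) (‖f‖ ^ 2) := by
  simpa using lp.hasSum_norm (p := 2) (by norm_num) f

/-- The slice `a ↦ ψ(x[r ↦ a])` of a vector `ψ` along the register `r`. -/
def slice (B : ProductBasis ty) (r : Register Var n) (x : B.carrier) :
    AllSpace B →ₗ[ℂ] RegSpace ty r where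
  toFun ψ := ⟨fun a => ψ (upd B r x a), (memLp_iff _).2
    ((hasSum_normSq ψ).summable.comp_injective (upd_injective B r x))⟩
  map_add' _ _ := rfl
  map_smul' _ _ := rfl

theorem slice_upd (B : ProductBasis ty) (r : Register Var n) (x : B.carrier) (a : RegIdx ty r)
    (ψ : AllSpace B) : slice B r (upd B r x a) ψ = slice B r x ψ := by
  ext b
  change ψ (upd B r (upd B r x a) b) = ψ (upd B r x b)
  have h : upd B r (upd B r x a) b = upd B r x b := Subtype.ext (updReg_updReg r x.1 a b)
  rw [h]

/-- The values of `(A ⊗ I) ψ`. -/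
def cylFun (B : ProductBasis ty) (r : Register Var n) (A : RegSpace ty r →L[ℂ] RegSpace ty r)
    (ψ : AllSpace B) (x : B.carrier) : ℂ :=
  A (slice B r x ψ) (readReg r x.1)

theorem cylFun_bound (B : ProductBasis ty) (r : Register Var n)
    (A : RegSpace ty r →L[ℂ] RegSpace ty r) (ψ : AllSpace B) :
    Summable (fun x => ‖cylFun B r A ψ x‖ ^ 2) ∧
      ∑' x, ‖cylFun B r A ψ x‖ ^ 2 ≤ (‖A‖ * ‖ψ‖) ^ 2 := by
  have hψ : HasSum (fun p : Env B r × RegIdx ty r => ‖ψ (splitEquiv B r p)‖ ^ 2) (‖ψ‖ ^ 2) :=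
    (splitEquiv B r).hasSum_iff.2 (hasSum_normSq ψ)
  have hs : HasSum (fun e : Env B r => ‖slice B r e.1 ψ‖ ^ 2) (‖ψ‖ ^ 2) :=
    hψ.prod_fiberwise fun e => hasSum_normSq (slice B r e.1 ψ)
  have hval : ∀ (e : Env B r) (a : RegIdx ty r),
      cylFun B r A ψ (splitEquiv B r (e, a)) = A (slice B r e.1 ψ) a := by
    intro e a
    change A (slice B r (upd B r e.1 a) ψ) (readReg r (updReg r e.1.1 a)) = _
    rw [slice_upd, readReg_updReg]
  have hrow : ∀ e : Env B r,
      HasSum (fun a => ‖cylFun B r A ψ (splitEquiv B r (e, a))‖ ^ 2)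
        (‖A (slice B r e.1 ψ)‖ ^ 2) := by
    intro e
    simp only [hval]
    exact hasSum_normSq _
  have hle : ∀ e : Env B r, ‖A (slice B r e.1 ψ)‖ ^ 2 ≤ ‖A‖ ^ 2 * ‖slice B r e.1 ψ‖ ^ 2 := by
    intro e
    rw [← mul_pow]
    exact pow_le_pow_left₀ (norm_nonneg _) (A.le_opNorm _) 2
  have hsum : Summable (fun e : Env B r => ‖A (slice B r e.1 ψ)‖ ^ 2) :=
    Summable.of_nonneg_of_le (fun _ => by positivity) hle (hs.summable.mul_left _)
  have hprod : Summable (fun p : Env B r × RegIdx ty r =>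
      ‖cylFun B r A ψ (splitEquiv B r p)‖ ^ 2) := by
    refine (summable_prod_of_nonneg (fun _ => by positivity)).2 ⟨fun e => (hrow e).summable, ?_⟩
    simpa only [(hrow _).tsum_eq] using hsum
  refine ⟨(splitEquiv B r).summable_iff.1 hprod, ?_⟩
  rw [← (splitEquiv B r).tsum_eq, hprod.tsum_prod' fun e => (hrow e).summable]
  simp only [(hrow _).tsum_eq]
  calc ∑' e : Env B r, ‖A (slice B r e.1 ψ)‖ ^ 2
      ≤ ∑' e : Env B r, ‖A‖ ^ 2 * ‖slice B r e.1 ψ‖ ^ 2 :=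
        hsum.tsum_le_tsum hle (hs.summable.mul_left _)
    _ = (‖A‖ * ‖ψ‖) ^ 2 := by rw [tsum_mul_left, hs.tsum_eq, mul_pow]

/-- The cylinder extension `A ⊗ I` of an operator `A` on a register to all variables:
`((A ⊗ I) ψ)(x) = (A ψ_x)(x|_r)` with `ψ_x(a) = ψ(x[r ↦ a])`. -/
def cyl (B : ProductBasis ty) (r : Register Var n) (A : RegSpace ty r →L[ℂ] RegSpace ty r) :
    AllOp B :=
  LinearMap.mkContinuous
    { toFun := fun ψ => ⟨cylFun B r A ψ, (memLp_iff _).2 (cylFun_bound B r A ψ).1⟩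
      map_add' := fun φ ψ => by
        ext x
        change A (slice B r x (φ + ψ)) _ = A (slice B r x φ) _ + A (slice B r x ψ) _
        rw [map_add, map_add]
        rfl
      map_smul' := fun c ψ => by
        ext x
        change A (slice B r x (c • ψ)) _ = c • A (slice B r x ψ) _
        rw [map_smul, map_smul]
        rfl } ‖A‖
    (fun ψ => by
      refine le_of_sq_le_sq ?_ (by positivity)
      rw [← (hasSum_normSq _).tsum_eq]
      exact (cylFun_bound B r A ψ).2)

/-! ## Syntax -/

/-- Quantum while-programs. -/
inductive Prog (ty : Var → QType) : Type 1
  /-- `skip` -/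
  | skip : Prog ty
  /-- `q := 0` -/
  | init (q : Var) : Prog ty
  /-- `r := U r` -/
  | unitary {n : ℕ} (r : Register Var n) (U : RegSpace ty r →L[ℂ] RegSpace ty r)
      (hU : ContinuousLinearMap.adjoint U ∘L U = ContinuousLinearMap.id ℂ (RegSpace ty r)) :
      Prog ty
  /-- `S₁; S₂` -/
  | seq (S₁ S₂ : Prog ty) : Prog ty
  /-- `measure M[r] : (S_m)_m` -/
  | measure {n : ℕ} (r : Register Var n) {ι : Type} (M : Measurement ι (RegSpace ty r))
      (S : ι → Prog ty) : Prog ty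
  /-- `while M[r] = 1 do S` -/
  | loop {n : ℕ} (r : Register Var n) (M : Measurement (Fin 2) (RegSpace ty r))
      (S : Prog ty) : Prog ty

/-- A program still to be executed; `none` is the empty program `E`. -/
abbrev Rest (ty : Var → QType) : Type 1 := Option (Prog ty)

/-- `S'; S` with the convention `E; S = S`. -/
def Rest.seq : Rest ty → Prog ty → Prog ty
  | none, S => S
  | some S', S => .seq S' S

/-! ## Operational semantics -/

/-- A basis label of the variable `q`, as a label of the register consisting of `q`. -/
def singleIdx (q : Var) (a : Idx (ty q)) : RegIdx ty (single q) := fun _ => a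

/-- The operator `|a⟩_q⟨b|` on the state space of all variables. -/
def ketbraAt (B : ProductBasis ty) (q : Var) (a b : Idx (ty q)) : AllOp B :=
  cyl B (single q) (ketbra (singleIdx q a) (singleIdx q b))

/-- The state after the initialisation of `q`: the sum of `|0⟩_q⟨k| ρ |k⟩_q⟨0|` over the
computational basis `|k⟩` of the state space of `q`. -/
def initState (B : ProductBasis ty) (q : Var) (ρ : AllOp B) : AllOp B :=
  ∑' k : Idx (ty q), ketbraAt B q (zeroIdx (ty q)) k ∘L ρ ∘L ketbraAt B q k (zeroIdx (ty q))

/-- The transitions `⟨S, ρ⟩ → ⟨S', ρ'⟩`. An element of `Step B S ρ S' ρ'` is a transition, so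
that transitions for different measurement outcomes are different, even when they lead to the
same configuration. -/
inductive Step (B : ProductBasis ty) : Prog ty → AllOp B → Rest ty → AllOp B → Type 1
  | skip (ρ : AllOp B) : Step B .skip ρ none ρ
  | init (q : Var) (ρ : AllOp B) : Step B (.init q) ρ none (initState B q ρ)
  | unitary {n : ℕ} (r : Register Var n) (U : RegSpace ty r →L[ℂ] RegSpace ty r)
      (hU : ContinuousLinearMap.adjoint U ∘L U = ContinuousLinearMap.id ℂ (RegSpace ty r))
      (ρ : AllOp B) : Step B (.unitary r U hU) ρ none (conj (cyl B r U) ρ)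
  | seq {S₁ : Prog ty} {ρ : AllOp B} {S₁' : Rest ty} {ρ' : AllOp B} (S₂ : Prog ty)
      (h : Step B S₁ ρ S₁' ρ') : Step B (.seq S₁ S₂) ρ (some (S₁'.seq S₂)) ρ'
  | measure {n : ℕ} (r : Register Var n) {ι : Type} (M : Measurement ι (RegSpace ty r))
      (S : ι → Prog ty) (ρ : AllOp B) (m : ι) :
      Step B (.measure r M S) ρ (some (S m)) (conj (cyl B r (M.op m)) ρ)
  | loop0 {n : ℕ} (r : Register Var n) (M : Measurement (Fin 2) (RegSpace ty r)) (S : Prog ty)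
      (ρ : AllOp B) : Step B (.loop r M S) ρ none (conj (cyl B r (M.op 0)) ρ)
  | loop1 {n : ℕ} (r : Register Var n) (M : Measurement (Fin 2) (RegSpace ty r)) (S : Prog ty)
      (ρ : AllOp B) :
      Step B (.loop r M S) ρ (some (.seq S (.loop r M S))) (conj (cyl B r (M.op 1)) ρ)

/-- Finite transition sequences `⟨S, ρ⟩ →* ⟨S', ρ'⟩`. -/
inductive Steps (B : ProductBasis ty) : Rest ty → AllOp B → Rest ty → AllOp B → Type 1
  | refl (S : Rest ty) (ρ : AllOp B) : Steps B S ρ S ρ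
  | head {S : Prog ty} {ρ : AllOp B} {S' : Rest ty} {ρ' : AllOp B} {S'' : Rest ty}
      {ρ'' : AllOp B} (h : Step B S ρ S' ρ') (t : Steps B S' ρ' S'' ρ'') :
      Steps B (some S) ρ S'' ρ''

/-- The terminating computations of `S` from `ρ`: a final state `ρ'` with a transition sequence
`⟨S, ρ⟩ →* ⟨E, ρ'⟩`. -/
def Computation (B : ProductBasis ty) (S : Prog ty) (ρ : AllOp B) : Type 1 :=
  Σ ρ' : AllOp B, Steps B (some S) ρ none ρ'

/-! ## Denotational semantics -/

/-- The semantic function `⟦S⟧(ρ)`: the sum of the multiset `{| ρ' : ⟨S, ρ⟩ →* ⟨E, ρ'⟩ |}`,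
each `ρ'` counted once for every computation leading to it (in the operator norm topology). -/
def denote (B : ProductBasis ty) (S : Prog ty) (ρ : AllOp B) : AllOp B :=
  ∑' c : Computation B S ρ, c.1

/-- The finite unfoldings `(while M[r] = 1 do S)ⁿ`, starting from the program `Ω`. -/
def unfold (Ω : Prog ty) (r : Register Var n) (M : Measurement (Fin 2) (RegSpace ty r))
    (S : Prog ty) : ℕ → Prog ty
  | 0 => Ω
  | k + 1 => .measure r M ![.skip, .seq S (unfold Ω r M S k)]

/-- The program `while M_trivial[q] = 1 do skip`. -/
def diverge (ty : Var → QType) (q : Var) : Prog ty := .loop (single q) Measurement.trivial .skip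

end

end QWhile

open QWhile

/-! Which transitions are available depends on the program only, never on the state. Hence the
terminating computations of `S` from `ρ` are in bijection with a type `Outcome S` not involving `ρ`
(lists of body outcomes for a loop), and the final state is an explicit map `eval B S p ρ`
(`exists_outcomeEquiv`). The semantics becomes `∑' p, eval B S p ρ`, over an index type in `Type`.

By induction on `S`, the family `eval B S` is an instrument (`isInstrument_eval`): positive,
additive over families of positive operators with finite total trace, and together not increasing
the trace. For positive operators the norm is at most the trace (`enorm_le_trace`), so this trace
budget makes every sum converge absolutely in norm. Traces take values in `[0, ∞]`, where sums may
be exchanged freely.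

The equations are then regroupings of summable families: by the outcomes of the first program for a
composition, by the measured value for a measurement, by the length of the list for a loop
(`hasSum_listEval_iterate`). The unfoldings of a loop are the partial sums of its series of positive
terms, so its limit is their least upper bound. -/

namespace QWhile

open scoped ENNReal

noncomputable section

/-! ### Traces of positive operators via Hilbert-Schmidt norms -/

section Trace

open ContinuousLinearMap

theorem enorm_sq_eq_ofReal {E : Type*} [NormedAddCommGroup E] (x : E) :
    ‖x‖ₑ ^ 2 = ENNReal.ofReal (‖x‖ ^ 2) := by
  rw [ENNReal.ofReal_pow (norm_nonneg _), ofReal_norm]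

theorem summable_of_tsum_ofReal_ne_top {ι : Type*} {f : ι → ℝ} (hf : ∀ i, 0 ≤ f i)
    (h : ∑' i, ENNReal.ofReal (f i) ≠ ⊤) : Summable f := by
  simpa only [ENNReal.toReal_ofReal (hf _)] using ENNReal.summable_toReal h

theorem hasSum_sq_iff_tsum_enorm_sq {ι E F : Type*} [NormedAddCommGroup E]
    [NormedAddCommGroup F] (f : ι → E) (x : F) :
    HasSum (fun i => ‖f i‖ ^ 2) (‖x‖ ^ 2) ↔ ∑' i, ‖f i‖ₑ ^ 2 = ‖x‖ₑ ^ 2 := by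
  simp only [enorm_sq_eq_ofReal]
  constructor
  · intro h
    rw [← h.tsum_eq, ENNReal.ofReal_tsum_of_nonneg (fun _ => by positivity) h.summable]
  · intro h
    have hs : Summable (fun i => ‖f i‖ ^ 2) :=
      summable_of_tsum_ofReal_ne_top (fun _ => by positivity) (by
        rw [h]
        exact ENNReal.ofReal_ne_top)
    rw [← ENNReal.ofReal_tsum_of_nonneg (fun _ => by positivity) hs,
      ENNReal.ofReal_eq_ofReal_iff (tsum_nonneg fun _ => by positivity) (by positivity)] at h
    exact h ▸ hs.hasSum

theorem tsum_enorm_inner_sq {H ι : Type*} [NormedAddCommGroup H] [InnerProductSpace ℂ H]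
    (b : HilbertBasis ι ℂ H) (x : H) :
    ∑' i, ‖⟪b i, x⟫_ℂ‖ₑ ^ 2 = ‖x‖ₑ ^ 2 := by
  rw [← hasSum_sq_iff_tsum_enorm_sq]
  have h := hasSum_normSq (b.repr x)
  simpa only [b.repr_apply_apply, LinearIsometryEquiv.norm_map] using h

variable {H : Type*} [NormedAddCommGroup H] [InnerProductSpace ℂ H] [CompleteSpace H]

/-- The square of the Hilbert-Schmidt norm of `T`, computed in the orthonormal basis `b`. -/
def hsSq {ι : Type*} (b : HilbertBasis ι ℂ H) (T : H →L[ℂ] H) : ℝ≥0∞ := ∑' i, ‖T (b i)‖ₑ ^ 2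

/-- Both sides are the double sum of `|⟨c j, T (b i)⟩|²` by Parseval, summed in the two orders. With
`T` self-adjoint this also gives independence of the basis. -/
theorem hsSq_adjoint {ι κ : Type*} (b : HilbertBasis ι ℂ H) (c : HilbertBasis κ ℂ H)
    (T : H →L[ℂ] H) : hsSq b T = hsSq c (adjoint T) := by
  simp only [hsSq, ← tsum_enorm_inner_sq c (T _), ← tsum_enorm_inner_sq b (adjoint T _)]
  rw [ENNReal.tsum_comm]
  refine tsum_congr fun j => tsum_congr fun i => ?_
  rw [← adjoint_inner_left, ← inner_conj_symm, RCLike.enorm_conj]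

/-- The trace of a positive operator, computed in the orthonormal basis `b`. -/
def traceOn {ι : Type*} (b : HilbertBasis ι ℂ H) (ρ : H →L[ℂ] H) : ℝ≥0∞ :=
  ∑' i, ENNReal.ofReal (⟪b i, ρ (b i)⟫_ℂ).re

theorem traceOn_adjoint_comp_self {ι : Type*} (b : HilbertBasis ι ℂ H) (T : H →L[ℂ] H) :
    traceOn b (adjoint T ∘L T) = hsSq b T := by
  refine tsum_congr fun i => ?_
  rw [comp_apply, adjoint_inner_right, enorm_sq_eq_ofReal, ← inner_self_eq_norm_sq (𝕜 := ℂ)]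
  rfl

theorem exists_isSelfAdjoint_comp_self {ρ : H →L[ℂ] H} (hρ : 0 ≤ ρ) :
    ∃ T : H →L[ℂ] H, adjoint T = T ∧ ρ = T ∘L T := by
  refine ⟨CFC.sqrt ρ, ?_, (CFC.sqrt_mul_sqrt_self ρ hρ).symm⟩
  exact (IsSelfAdjoint.of_nonneg (CFC.sqrt_nonneg ρ)).star_eq

theorem traceOn_eq {ι κ : Type*} (b : HilbertBasis ι ℂ H) (c : HilbertBasis κ ℂ H)
    {ρ : H →L[ℂ] H} (hρ : 0 ≤ ρ) : traceOn b ρ = traceOn c ρ := by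
  obtain ⟨T, hT, rfl⟩ := exists_isSelfAdjoint_comp_self hρ
  have hb := traceOn_adjoint_comp_self b T
  have hc := traceOn_adjoint_comp_self c T
  rw [hT] at hb hc
  rw [hb, hc, hsSq_adjoint b c, hT]

variable (H) in
/-- An orthonormal basis of `H`. -/
def someBasis : HilbertBasis (exists_hilbertBasis ℂ H).choose ℂ H :=
  (exists_hilbertBasis ℂ H).choose_spec.choose

/-- The trace of a positive operator. -/
def trace (ρ : H →L[ℂ] H) : ℝ≥0∞ := traceOn (someBasis H) ρ

theorem isPartialDensity_iff {ρ : H →L[ℂ] H} : IsPartialDensity ρ ↔ 0 ≤ ρ ∧ trace ρ ≤ 1 := by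
  rw [IsPartialDensity, ← nonneg_iff_isPositive]
  refine and_congr_right fun hρ => ?_
  have hpos := (nonneg_iff_isPositive ρ).1 hρ
  have hre : ∀ x : H, 0 ≤ (⟪x, ρ x⟫_ℂ).re := fun x => hpos.re_inner_nonneg_right x
  -- Diagonal entries of a positive operator are real, so complex summability reduces to that of the
  -- real parts.
  have him : ∀ x : H, ((⟪x, ρ x⟫_ℂ).re : ℂ) = ⟪x, ρ x⟫_ℂ := fun x => by
    have := hpos.inner_nonneg_right x
    rw [Complex.le_def] at this
    exact Complex.ext rfl this.2
  constructor
  · intro h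
    obtain ⟨hs, hle⟩ := h _ (someBasis H)
    have hs' := Complex.reCLM.summable hs
    rw [trace, traceOn, ← ENNReal.ofReal_tsum_of_nonneg (fun _ => hre _) hs', ENNReal.ofReal_le_one]
    refine le_of_eq_of_le ?_ hle
    exact (Complex.reCLM.map_tsum hs).symm
  · intro h s b
    -- The definition quantifies over all bases; basis independence makes the bound in one of them
    -- enough.
    rw [trace, traceOn_eq _ b hρ, traceOn] at h
    have hs : Summable fun i => (⟪b i, ρ (b i)⟫_ℂ).re :=
      summable_of_tsum_ofReal_ne_top (fun _ => hre _) (ne_top_of_le_ne_top (by simp) h)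
    have hs' : Summable fun i => ⟪b i, ρ (b i)⟫_ℂ := by
      simpa only [Complex.ofRealCLM_apply, him] using Complex.ofRealCLM.summable hs
    refine ⟨hs', ?_⟩
    rw [← ENNReal.ofReal_tsum_of_nonneg (fun _ => hre _) hs, ENNReal.ofReal_le_one] at h
    refine le_of_eq_of_le ?_ h
    exact Complex.reCLM.map_tsum hs'

/-- Write `ρ = T²` with `T` self-adjoint. Parseval and Cauchy-Schwarz bound the squared operator
norm of `T` by its squared Hilbert-Schmidt norm, which is the trace of `ρ`. -/
theorem enorm_le_trace {ρ : H →L[ℂ] H} (hρ : 0 ≤ ρ) : ‖ρ‖ₑ ≤ trace ρ := by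
  obtain ⟨T, hT, rfl⟩ := exists_isSelfAdjoint_comp_self hρ
  have htr := traceOn_adjoint_comp_self (someBasis H) T
  rw [hT] at htr
  rw [trace, htr]
  have hbound : ∀ x : H, ‖T x‖ₑ ^ 2 ≤ hsSq (someBasis H) T * ‖x‖ₑ ^ 2 := by
    intro x
    rw [← tsum_enorm_inner_sq (someBasis H) (T x), hsSq, ← ENNReal.tsum_mul_right]
    refine ENNReal.tsum_le_tsum fun i => ?_
    rw [← mul_pow, ← adjoint_inner_left, hT]
    gcongr
    rw [← ofReal_norm, ← ofReal_norm, ← ofReal_norm,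
      ← ENNReal.ofReal_mul (norm_nonneg _)]
    exact ENNReal.ofReal_le_ofReal (norm_inner_le_norm _ _)
  rcases eq_or_ne (hsSq (someBasis H) T) ⊤ with h | h
  · simp [h]
  have hreal : ‖T‖ ≤ Real.sqrt (hsSq (someBasis H) T).toReal := by
    refine T.opNorm_le_bound (Real.sqrt_nonneg _) fun x => ?_
    refine Real.le_sqrt_of_sq_le ?_ |>.trans_eq (Real.sqrt_mul_self (by positivity))
    have := ENNReal.toReal_mono (ENNReal.mul_ne_top h (by simp)) (hbound x)
    rw [ENNReal.toReal_mul, ENNReal.toReal_pow, ENNReal.toReal_pow, toReal_enorm, toReal_enorm]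
      at this
    rwa [mul_mul_mul_comm, Real.mul_self_sqrt ENNReal.toReal_nonneg, ← sq]
  rw [← ENNReal.ofReal_toReal h, ← ofReal_norm]
  refine ENNReal.ofReal_le_ofReal ?_
  calc ‖T ∘L T‖ ≤ ‖T‖ * ‖T‖ := opNorm_comp_le _ _
    _ ≤ _ := by
      rw [← Real.mul_self_sqrt (ENNReal.toReal_nonneg (a := hsSq (someBasis H) T))]
      gcongr

theorem summable_of_trace {ι : Type*} {ρ : ι → H →L[ℂ] H} (hρ : ∀ i, 0 ≤ ρ i)
    (h : ∑' i, trace (ρ i) ≠ ⊤) : Summable ρ := by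
  refine Summable.of_norm_bounded (ENNReal.summable_toReal h) fun i => ?_
  rw [← toReal_enorm]
  exact ENNReal.toReal_mono (ENNReal.ne_top_of_tsum_ne_top h i) (enorm_le_trace (hρ i))

/-- Each diagonal entry is norm continuous, hence commutes with the sum; the two sums of nonnegative
terms are then exchanged. -/
theorem trace_tsum {ι : Type*} {ρ : ι → H →L[ℂ] H} (hρ : ∀ i, 0 ≤ ρ i)
    (h : Summable ρ) : trace (∑' i, ρ i) = ∑' i, trace (ρ i) := by
  simp only [trace, traceOn]
  rw [ENNReal.tsum_comm]
  refine tsum_congr fun j => ?_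
  have hs : HasSum (fun i => (⟪someBasis H j, ρ i (someBasis H j)⟫_ℂ).re)
      (⟪someBasis H j, (∑' i, ρ i) (someBasis H j)⟫_ℂ).re :=
    ((Complex.reCLM ∘L (innerSL ℂ (someBasis H j)).restrictScalars ℝ ∘L
      (ContinuousLinearMap.apply ℂ H (someBasis H j)).restrictScalars ℝ).hasSum h.hasSum)
  rw [← ENNReal.ofReal_tsum_of_nonneg (fun i => ?_) hs.summable]
  · congr 1
    exact hs.tsum_eq.symm
  · exact ((nonneg_iff_isPositive _).1 (hρ i)).re_inner_nonneg_right _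

theorem conj_nonneg (T : H →L[ℂ] H) {ρ : H →L[ℂ] H} (hρ : 0 ≤ ρ) : 0 ≤ conj T ρ :=
  (nonneg_iff_isPositive _).2 (((nonneg_iff_isPositive _).1 hρ).conj_adjoint T)

/-- `conj T` as a continuous linear map. -/
def conjCLM (T : H →L[ℂ] H) : (H →L[ℂ] H) →L[ℂ] (H →L[ℂ] H) :=
  (compL ℂ H H H T) ∘L ((compL ℂ H H H).flip (adjoint T))

/-- With `ρ = R²`, the trace of `T ρ T†` is the squared Hilbert-Schmidt norm of `R T†`, hence of its
adjoint `T R`. Summing over `i` first and applying `hT` to the vectors `R (b j)` leaves that of `R`.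
No trace-class theory or cyclicity of the trace is needed. -/
theorem tsum_trace_conj {ι : Type*} {T : ι → H →L[ℂ] H}
    (hT : ∀ x, ∑' i, ‖T i x‖ₑ ^ 2 = ‖x‖ₑ ^ 2) {ρ : H →L[ℂ] H} (hρ : 0 ≤ ρ) :
    ∑' i, trace (conj (T i) ρ) = trace ρ := by
  obtain ⟨R, hR, rfl⟩ := exists_isSelfAdjoint_comp_self hρ
  have h1 : ∀ i, trace (conj (T i) (R ∘L R)) = hsSq (someBasis H) (T i ∘L R) := fun i => by
    have : conj (T i) (R ∘L R) = adjoint (R ∘L adjoint (T i)) ∘L (R ∘L adjoint (T i)) := by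
      rw [adjoint_comp, adjoint_adjoint, hR]
      rfl
    rw [this, trace, traceOn_adjoint_comp_self, hsSq_adjoint _ (someBasis H), adjoint_comp,
      adjoint_adjoint, hR]
  have h2 := traceOn_adjoint_comp_self (someBasis H) R
  rw [hR] at h2
  simp only [h1]
  rw [trace, h2]
  simp only [hsSq, comp_apply]
  rw [ENNReal.tsum_comm]
  simp only [hT]

end Trace

/-! ### Instruments and their closure properties -/

section Instruments

variable {H : Type*} [NormedAddCommGroup H] [InnerProductSpace ℂ H] [CompleteSpace H]

/-- A quantum instrument: a family of maps on positive trace class operators that are additive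
on countable sums and that together do not increase the trace. -/
structure IsInstrument {I : Type} (Φ : I → (H →L[ℂ] H) → (H →L[ℂ] H)) : Prop where
  nonneg : ∀ ρ, 0 ≤ ρ → trace ρ ≠ ⊤ → ∀ i, 0 ≤ Φ i ρ
  tsum_trace_le : ∀ ρ, 0 ≤ ρ → trace ρ ≠ ⊤ → ∑' i, trace (Φ i ρ) ≤ trace ρ
  map_tsum : ∀ {J : Type} (ρ : J → H →L[ℂ] H), (∀ j, 0 ≤ ρ j) → ∑' j, trace (ρ j) ≠ ⊤ →
    ∀ i, Φ i (∑' j, ρ j) = ∑' j, Φ i (ρ j)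

/-- An instrument with one outcome. -/
abbrev IsOperation (F : (H →L[ℂ] H) → (H →L[ℂ] H)) : Prop := IsInstrument fun _ : Unit => F

namespace IsInstrument

variable {I : Type} {Φ : I → (H →L[ℂ] H) → (H →L[ℂ] H)}

theorem tsum_trace_ne_top (h : IsInstrument Φ) {ρ : H →L[ℂ] H} (hρ : 0 ≤ ρ)
    (ht : trace ρ ≠ ⊤) : ∑' i, trace (Φ i ρ) ≠ ⊤ :=
  ne_top_of_le_ne_top ht (h.tsum_trace_le ρ hρ ht)

theorem trace_ne_top (h : IsInstrument Φ) {ρ : H →L[ℂ] H} (hρ : 0 ≤ ρ)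
    (ht : trace ρ ≠ ⊤) (i : I) : trace (Φ i ρ) ≠ ⊤ :=
  ENNReal.ne_top_of_tsum_ne_top (h.tsum_trace_ne_top hρ ht) i

theorem summable (h : IsInstrument Φ) {ρ : H →L[ℂ] H} (hρ : 0 ≤ ρ) (ht : trace ρ ≠ ⊤) :
    Summable fun i => Φ i ρ :=
  summable_of_trace (h.nonneg ρ hρ ht) (h.tsum_trace_ne_top hρ ht)

theorem total (h : IsInstrument Φ) : IsOperation fun ρ => ∑' i, Φ i ρ where
  nonneg ρ hρ ht _ := tsum_nonneg (h.nonneg ρ hρ ht)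
  tsum_trace_le ρ hρ ht := by
    rw [tsum_fintype, Fintype.sum_unique, trace_tsum (h.nonneg ρ hρ ht) (h.summable hρ ht)]
    exact h.tsum_trace_le ρ hρ ht
  map_tsum {J} ρ hρ ht _ := by
    have htj := ENNReal.ne_top_of_tsum_ne_top ht
    simp only [h.map_tsum ρ hρ ht]
    -- The exchange needs joint summability in outcome and index; the total trace over both is at
    -- most that of the `ρ j`.
    refine (Summable.tsum_comm (f := fun i j => Φ i (ρ j)) ?_).symm ▸ rfl
    refine summable_of_trace (fun p => h.nonneg _ (hρ p.2) (htj p.2) p.1) ?_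
    refine ne_top_of_le_ne_top ht ?_
    simp only [Function.uncurry_def]
    rw [ENNReal.tsum_prod (f := fun i j => trace (Φ i (ρ j))), ENNReal.tsum_comm]
    exact ENNReal.tsum_le_tsum fun j => h.tsum_trace_le _ (hρ j) (htj j)

theorem sigma (h : IsInstrument Φ) {K : I → Type} {Ψ : (i : I) → K i → (H →L[ℂ] H) → (H →L[ℂ] H)}
    (hΨ : ∀ i, IsInstrument (Ψ i)) :
    IsInstrument fun (p : Σ i, K i) ρ => Ψ p.1 p.2 (Φ p.1 ρ) where
  nonneg ρ hρ ht p := (hΨ p.1).nonneg _ (h.nonneg ρ hρ ht p.1) (h.trace_ne_top hρ ht p.1) p.2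
  tsum_trace_le ρ hρ ht := by
    rw [ENNReal.tsum_sigma']
    refine le_trans (ENNReal.tsum_le_tsum fun i => ?_) (h.tsum_trace_le ρ hρ ht)
    exact (hΨ i).tsum_trace_le _ (h.nonneg ρ hρ ht i) (h.trace_ne_top hρ ht i)
  map_tsum {J} ρ hρ ht p := by
    have htj := ENNReal.ne_top_of_tsum_ne_top ht
    rw [h.map_tsum ρ hρ ht, (hΨ p.1).map_tsum _ (fun j => h.nonneg _ (hρ j) (htj j) _)]
    refine ne_top_of_le_ne_top ht (ENNReal.tsum_le_tsum fun j => ?_)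
    exact (ENNReal.le_tsum p.1).trans (h.tsum_trace_le _ (hρ j) (htj j))

theorem reindex (h : IsInstrument Φ) {K : Type} (e : K ≃ I) :
    IsInstrument fun k => Φ (e k) where
  nonneg ρ hρ ht k := h.nonneg ρ hρ ht _
  tsum_trace_le ρ hρ ht := by
    rw [e.tsum_eq fun i => trace (Φ i ρ)]
    exact h.tsum_trace_le ρ hρ ht
  map_tsum ρ hρ ht k := h.map_tsum ρ hρ ht _

theorem prod (h : IsInstrument Φ) {K : Type} {Ψ : K → (H →L[ℂ] H) → (H →L[ℂ] H)}
    (hΨ : IsInstrument Ψ) : IsInstrument fun (p : I × K) ρ => Ψ p.2 (Φ p.1 ρ) :=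
  (h.sigma fun _ => hΨ).reindex (Equiv.sigmaEquivProd I K).symm

theorem single (h : IsInstrument Φ) (i : I) : IsOperation (Φ i) where
  nonneg ρ hρ ht _ := h.nonneg ρ hρ ht i
  tsum_trace_le ρ hρ ht := by
    rw [tsum_fintype, Fintype.sum_unique]
    exact (ENNReal.le_tsum i).trans (h.tsum_trace_le ρ hρ ht)
  map_tsum ρ hρ ht _ := h.map_tsum ρ hρ ht i

theorem id : IsOperation fun ρ : H →L[ℂ] H => ρ where
  nonneg _ hρ _ _ := hρ
  tsum_trace_le ρ _ _ := by rw [tsum_fintype, Fintype.sum_unique]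
  map_tsum _ _ _ _ := rfl

theorem conj {T : I → H →L[ℂ] H} (hT : ∀ x, ∑' i, ‖T i x‖ₑ ^ 2 = ‖x‖ₑ ^ 2) :
    IsInstrument fun i => QWhile.conj (T i) where
  nonneg _ hρ _ i := conj_nonneg (T i) hρ
  tsum_trace_le _ hρ _ := (tsum_trace_conj hT hρ).le
  map_tsum _ hρ ht i := (conjCLM (T i)).map_tsum (summable_of_trace hρ ht)

end IsInstrument

namespace IsOperation

variable {F G : (H →L[ℂ] H) → (H →L[ℂ] H)}

theorem nonneg (h : IsOperation F) {ρ : H →L[ℂ] H} (hρ : 0 ≤ ρ) (ht : trace ρ ≠ ⊤) : 0 ≤ F ρ :=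
  IsInstrument.nonneg h ρ hρ ht ()

theorem trace_le (h : IsOperation F) {ρ : H →L[ℂ] H} (hρ : 0 ≤ ρ) (ht : trace ρ ≠ ⊤) :
    trace (F ρ) ≤ trace ρ := by
  have := IsInstrument.tsum_trace_le h ρ hρ ht
  rwa [tsum_fintype, Fintype.sum_unique] at this

theorem isPartialDensity (h : IsOperation F) {ρ : H →L[ℂ] H} (hρ : IsPartialDensity ρ) :
    IsPartialDensity (F ρ) := by
  rw [isPartialDensity_iff] at hρ ⊢
  have ht := ne_top_of_le_ne_top ENNReal.one_ne_top hρ.2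
  exact ⟨h.nonneg hρ.1 ht, (h.trace_le hρ.1 ht).trans hρ.2⟩

theorem comp (hG : IsOperation G) (hF : IsOperation F) : IsOperation fun ρ => G (F ρ) :=
  (hF.prod hG).reindex (Equiv.prodUnique Unit Unit).symm

theorem iterate (hF : IsOperation F) (k : ℕ) : IsOperation fun ρ => F^[k] ρ := by
  induction k with
  | zero => exact IsInstrument.id
  | succ k ih => exact ih.comp hF

end IsOperation

/-! ### Iterating an instrument until exit -/

section Repeat

variable {P : Type}

/-- Run the outcomes in the list one after the other and leave by `E₀`. -/
def listEval (E₀ : (H →L[ℂ] H) → (H →L[ℂ] H)) (Θ : P → (H →L[ℂ] H) → (H →L[ℂ] H)) :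
    List P → (H →L[ℂ] H) → (H →L[ℂ] H)
  | [], ρ => E₀ ρ
  | p :: l, ρ => listEval E₀ Θ l (Θ p ρ)

/-- A list of length `k + 1` is its first element together with a list of length `k`. -/
def consEquiv (P : Type) (k : ℕ) :
    P × {l : List P // l.length = k} ≃ {l : List P // l.length = k + 1} where
  toFun p := ⟨p.1 :: p.2.1, congrArg (· + 1) p.2.2⟩
  invFun
    | ⟨p :: l, h⟩ => (p, ⟨l, Nat.succ.inj h⟩)
  left_inv _ := rfl
  right_inv := by
    rintro ⟨_ | ⟨p, l⟩, h⟩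
    · exact absurd h (by simp)
    · rfl

theorem tsum_length_zero {E : Type*} [AddCommMonoid E] [TopologicalSpace E]
    (f : List P → E) : ∑' l : {l : List P // l.length = 0}, f l = f [] := by
  let : Unique {l : List P // l.length = 0} :=
    ⟨⟨⟨[], rfl⟩⟩, fun l => Subtype.ext (List.length_eq_zero_iff.1 l.2)⟩
  rw [tsum_fintype, Fintype.sum_unique]
  rfl

variable {E₀ : (H →L[ℂ] H) → (H →L[ℂ] H)} {Θ : P → (H →L[ℂ] H) → (H →L[ℂ] H)}

/-- By `hle`, the trace of `ρ` pays for leaving at once and for all states after one round; by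
induction, each of these pays for the runs that start from it. The bound does not depend on `N`. -/
theorem sum_trace_listEval_le (hΘ : IsInstrument Θ)
    (hle : ∀ ρ, 0 ≤ ρ → trace ρ ≠ ⊤ → trace (E₀ ρ) + ∑' p, trace (Θ p ρ) ≤ trace ρ) (N : ℕ) :
    ∀ ρ : H →L[ℂ] H, 0 ≤ ρ → trace ρ ≠ ⊤ →
      ∑ k ∈ Finset.range N, ∑' l : {l : List P // l.length = k}, trace (listEval E₀ Θ l ρ)
        ≤ trace ρ := by
  induction N with
  | zero => simp
  | succ N ih =>
    intro ρ hρ ht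
    refine le_trans ?_ (hle ρ hρ ht)
    rw [Finset.sum_range_succ', tsum_length_zero fun l => trace (listEval E₀ Θ l ρ), add_comm]
    refine add_le_add le_rfl ?_
    have hstep : ∀ k, ∑' l : {l : List P // l.length = k + 1}, trace (listEval E₀ Θ l ρ) =
        ∑' p, ∑' l : {l : List P // l.length = k}, trace (listEval E₀ Θ l (Θ p ρ)) := fun k => by
      rw [← (consEquiv P k).tsum_eq, ENNReal.tsum_prod']
      rfl
    simp only [hstep]
    rw [← Summable.tsum_finsetSum fun _ _ => ENNReal.summable]
    exact ENNReal.tsum_le_tsum fun p =>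
      ih _ (hΘ.nonneg ρ hρ ht p) (hΘ.trace_ne_top hρ ht p)

theorem IsInstrument.listEval (h₀ : IsOperation E₀) (hΘ : IsInstrument Θ)
    (hle : ∀ ρ, 0 ≤ ρ → trace ρ ≠ ⊤ → trace (E₀ ρ) + ∑' p, trace (Θ p ρ) ≤ trace ρ) :
    IsInstrument (listEval E₀ Θ) := by
  have hop : ∀ l, IsOperation (QWhile.listEval E₀ Θ l) := fun l => by
    induction l with
    | nil => exact h₀
    | cons p l ih => exact ih.comp (hΘ.single p)
  refine ⟨fun ρ hρ ht l => (hop l).nonneg hρ ht, fun ρ hρ ht => ?_,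
    fun ρ hρ ht l => (hop l).map_tsum ρ hρ ht ()⟩
  -- Grouped by length, the sum is the supremum of its partial sums over lengths below `N`, which
  -- are bounded uniformly.
  rw [← (Equiv.sigmaFiberEquiv List.length).tsum_eq, ENNReal.tsum_sigma',
    ENNReal.tsum_eq_iSup_nat]
  exact iSup_le fun N => sum_trace_listEval_le hΘ hle N ρ hρ ht

/-- Additivity collapses the runs of exactly `k` rounds into the `k`-th iterate of the total body
followed by the exit; the series over `k` is the sum over lists grouped by length. -/
theorem hasSum_listEval_iterate (h₀ : IsOperation E₀) (hΘ : IsInstrument Θ)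
    (hle : ∀ ρ, 0 ≤ ρ → trace ρ ≠ ⊤ → trace (E₀ ρ) + ∑' p, trace (Θ p ρ) ≤ trace ρ)
    {ρ : H →L[ℂ] H} (hρ : 0 ≤ ρ) (ht : trace ρ ≠ ⊤) :
    HasSum (fun k => E₀ ((fun σ => ∑' p, Θ p σ)^[k] ρ)) (∑' l, listEval E₀ Θ l ρ) := by
  have hL := IsInstrument.listEval h₀ hΘ hle
  have hk : ∀ (k : ℕ) (ρ : H →L[ℂ] H), 0 ≤ ρ → trace ρ ≠ ⊤ →
      ∑' l : {l : List P // l.length = k}, listEval E₀ Θ l ρ =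
        E₀ ((fun σ => ∑' p, Θ p σ)^[k] ρ) := by
    intro k
    induction k with
    | zero => exact fun ρ _ _ => tsum_length_zero fun l => listEval E₀ Θ l ρ
    | succ k ih =>
      intro ρ hρ ht
      have hs := ((hL.summable hρ ht).comp_injective
        (i := fun l : {l : List P // l.length = k + 1} => l.1) Subtype.val_injective)
      rw [← (consEquiv P k).summable_iff] at hs
      rw [← (consEquiv P k).tsum_eq]
      refine hs.tsum_prod.trans ?_
      have : ∀ p, ∑' l : {l : List P // l.length = k},
          listEval E₀ Θ (consEquiv P k (p, l)) ρ = E₀ ((fun σ => ∑' p, Θ p σ)^[k] (Θ p ρ)) :=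
        fun p => ih _ (hΘ.nonneg ρ hρ ht p) (hΘ.trace_ne_top hρ ht p)
      simp only [Function.comp_apply, this]
      -- Additivity of the remaining `k` rounds and the exit moves the sum over the first outcome
      -- inside.
      exact ((h₀.comp (hΘ.total.iterate k)).map_tsum _ (hΘ.nonneg ρ hρ ht)
        (hΘ.tsum_trace_ne_top hρ ht) ()).symm
  have hs := (Equiv.sigmaFiberEquiv (List.length (α := P))).hasSum_iff.2
    (hL.summable hρ ht).hasSum
  refine hs.sigma fun k => ?_
  rw [← hk k ρ hρ ht]
  exact ((hL.summable hρ ht).comp_injective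
    (i := fun l : {l : List P // l.length = k} => l.1) Subtype.val_injective).hasSum

end Repeat

end Instruments

/-! ### Cylinder extensions, measurements and initialisation as instruments -/

section Cylinder

open ContinuousLinearMap

variable {Var : Type} {ty : Var → QType} {n : ℕ}

theorem slice_splitEquiv (B : ProductBasis ty) (r : Register Var n) (e : Env B r)
    (a : RegIdx ty r) (ψ : AllSpace B) : ψ (splitEquiv B r (e, a)) = slice B r e.1 ψ a := rfl

/-- The slices over `Env B r` present `AllSpace B` as an `ℓ²` sum of copies of the register space.
The extension acts on each copy as `A`, so facts about it reduce to facts about `A`. -/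
theorem slice_cyl (B : ProductBasis ty) (r : Register Var n)
    (A : RegSpace ty r →L[ℂ] RegSpace ty r) (x : B.carrier) (ψ : AllSpace B) :
    slice B r x (cyl B r A ψ) = A (slice B r x ψ) := by
  ext a
  change A (slice B r (upd B r x a) ψ) (readReg r (updReg r x.1 a)) = _
  rw [slice_upd, readReg_updReg]

theorem allSpace_ext {B : ProductBasis ty} (r : Register Var n) {φ ψ : AllSpace B}
    (h : ∀ x, slice B r x φ = slice B r x ψ) : φ = ψ := by
  ext x
  obtain ⟨⟨e, a⟩, rfl⟩ := (splitEquiv B r).surjective x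
  rw [slice_splitEquiv, slice_splitEquiv, h]

theorem cyl_zero (B : ProductBasis ty) (r : Register Var n) : cyl B r 0 = 0 :=
  ContinuousLinearMap.ext fun ψ => allSpace_ext r fun x => by
    rw [slice_cyl, zero_apply, zero_apply, map_zero]

theorem hasSum_inner_slice (B : ProductBasis ty) (r : Register Var n) (φ ψ : AllSpace B) :
    HasSum (fun e : Env B r => ⟪slice B r e.1 φ, slice B r e.1 ψ⟫_ℂ) ⟪φ, ψ⟫_ℂ :=
  ((splitEquiv B r).hasSum_iff.2 (lp.hasSum_inner φ ψ)).prod_fiberwise fun e =>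
    lp.hasSum_inner (slice B r e.1 φ) (slice B r e.1 ψ)

theorem adjoint_cyl (B : ProductBasis ty) (r : Register Var n)
    (A : RegSpace ty r →L[ℂ] RegSpace ty r) : adjoint (cyl B r A) = cyl B r (adjoint A) := by
  symm
  rw [eq_adjoint_iff]
  intro φ ψ
  rw [← (hasSum_inner_slice B r _ _).tsum_eq, ← (hasSum_inner_slice B r _ _).tsum_eq]
  simp only [slice_cyl, adjoint_inner_left]

theorem tsum_enorm_slice_sq (B : ProductBasis ty) (r : Register Var n) (ψ : AllSpace B) :
    ∑' e : Env B r, ‖slice B r e.1 ψ‖ₑ ^ 2 = ‖ψ‖ₑ ^ 2 := by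
  rw [← hasSum_sq_iff_tsum_enorm_sq]
  exact ((splitEquiv B r).hasSum_iff.2 (hasSum_normSq ψ)).prod_fiberwise fun e =>
    hasSum_normSq (slice B r e.1 ψ)

theorem tsum_enorm_cyl_sq (B : ProductBasis ty) (r : Register Var n) {ι : Type*}
    {A : ι → RegSpace ty r →L[ℂ] RegSpace ty r}
    (hA : ∀ x, ∑' m, ‖A m x‖ₑ ^ 2 = ‖x‖ₑ ^ 2) (ψ : AllSpace B) :
    ∑' m, ‖cyl B r (A m) ψ‖ₑ ^ 2 = ‖ψ‖ₑ ^ 2 := by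
  simp only [← tsum_enorm_slice_sq B r, slice_cyl]
  rw [ENNReal.tsum_comm]
  simp only [hA]

/-- Pair the completeness relation with `x`. This scalar form is all that the trace bounds use. -/
theorem Measurement.tsum_enorm_sq {ι : Type} {H : Type*} [NormedAddCommGroup H]
    [InnerProductSpace ℂ H] [CompleteSpace H] (M : Measurement ι H) (x : H) :
    ∑' m, ‖M.op m x‖ₑ ^ 2 = ‖x‖ₑ ^ 2 := by
  rw [← hasSum_sq_iff_tsum_enorm_sq]
  have h := Complex.reCLM.hasSum ((innerSL ℂ x).hasSum (M.complete x))
  simp only [innerSL_apply_apply, adjoint_inner_right, Complex.reCLM_apply] at h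
  simp only [← inner_self_eq_norm_sq (𝕜 := ℂ)]
  exact h

theorem isInstrument_measurement (B : ProductBasis ty) (r : Register Var n) {ι : Type}
    (M : Measurement ι (RegSpace ty r)) : IsInstrument fun m => conj (cyl B r (M.op m)) :=
  .conj (tsum_enorm_cyl_sq B r M.tsum_enorm_sq)

theorem isOperation_unitary (B : ProductBasis ty) (r : Register Var n)
    (U : RegSpace ty r →L[ℂ] RegSpace ty r)
    (hU : adjoint U ∘L U = ContinuousLinearMap.id ℂ (RegSpace ty r)) :
    IsOperation (conj (cyl B r U)) :=
  -- An isometry is a measurement with a single outcome.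
  isInstrument_measurement B r (ι := Unit)
    { op := fun _ => U
      complete := fun ψ => by
        have e : adjoint U (U ψ) = ψ := congrArg (fun T => T ψ) hU
        simp [e] }

theorem norm_ket {I : Type*} (a : I) : ‖ket a‖ = 1 := by
  classical
  simp only [ket]
  rw [lp.norm_single (by norm_num)]
  simp

theorem inner_ket {I : Type*} (a : I) (x : L2 I) : ⟪ket a, x⟫_ℂ = x a := by
  classical
  simp only [ket]
  rw [lp.inner_single_left]
  simp

/-- The norm of `|a⟩⟨b|x` is `|x b|`. Hence initialisation is the total of an instrument that reads
the basis label and resets it. -/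
theorem tsum_enorm_ketbra_sq {I : Type*} (a : I) (x : L2 I) :
    ∑' b, ‖ketbra a b x‖ₑ ^ 2 = ‖x‖ₑ ^ 2 := by
  rw [← hasSum_sq_iff_tsum_enorm_sq]
  simpa [ketbra, norm_smul, norm_ket, inner_ket] using hasSum_normSq x

theorem adjoint_ketbra {I : Type*} (a b : I) : adjoint (ketbra a b) = ketbra b a :=
  InnerProductSpace.adjoint_rankOne _ _

theorem conj_ketbraAt (B : ProductBasis ty) (q : Var) (a b : Idx (ty q)) (ρ : AllOp B) :
    conj (ketbraAt B q a b) ρ = ketbraAt B q a b ∘L ρ ∘L ketbraAt B q b a := by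
  rw [conj, ketbraAt, adjoint_cyl, adjoint_ketbra, ketbraAt]

/-- Basis labels of a variable and of the register consisting of it. -/
def singleIdxEquiv (ty : Var → QType) (q : Var) : Idx (ty q) ≃ RegIdx ty (single q) where
  toFun := singleIdx q
  invFun a := a 0
  left_inv _ := rfl
  right_inv a := funext fun i => by rw [Subsingleton.elim i 0]; rfl

theorem isInstrument_ketbraAt (B : ProductBasis ty) (q : Var) :
    IsInstrument fun k => conj (ketbraAt B q (zeroIdx (ty q)) k) := by
  refine .conj (tsum_enorm_cyl_sq B (single q) fun x => ?_)
  rw [← tsum_enorm_ketbra_sq (singleIdx q (zeroIdx (ty q))) x, ← (singleIdxEquiv ty q).tsum_eq]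
  rfl

theorem initState_eq_tsum (B : ProductBasis ty) (q : Var) (ρ : AllOp B) :
    initState B q ρ = ∑' k, conj (ketbraAt B q (zeroIdx (ty q)) k) ρ := by
  simp only [initState, conj_ketbraAt]

theorem isOperation_initState (B : ProductBasis ty) (q : Var) : IsOperation (initState B q) := by
  have h := (isInstrument_ketbraAt B q).total
  rwa [← show initState B q = _ from funext (initState_eq_tsum B q)] at h

end Cylinder

/-! ### Decomposition of computations by program constructor -/

section Computations

variable {Var : Type} {ty : Var → QType} {B : ProductBasis ty}

namespace Steps

/-- Concatenation of transition sequences. -/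
def append {R R' R'' : Rest ty} {ρ ρ' ρ'' : AllOp B} :
    Steps B R ρ R' ρ' → Steps B R' ρ' R'' ρ'' → Steps B R ρ R'' ρ''
  | .refl _ _, t => t
  | .head h s, t => .head h (s.append t)

/-- A transition sequence of `S₁` as one of `S₁; S₂`. -/
def liftSeq (S₂ : Prog ty) {R R' : Rest ty} {ρ ρ' : AllOp B} :
    Steps B R ρ R' ρ' → Steps B (some (R.seq S₂)) ρ (some (R'.seq S₂)) ρ'
  | .refl _ _ => .refl _ _
  | .head h s => .head (.seq S₂ h) (s.liftSeq S₂)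

/-- The number of transitions. -/
def length {R R' : Rest ty} {ρ ρ' : AllOp B} : Steps B R ρ R' ρ' → ℕ
  | .refl _ _ => 0
  | .head _ s => s.length + 1

theorem length_append {R R' R'' : Rest ty} {ρ ρ' ρ'' : AllOp B} (s : Steps B R ρ R' ρ')
    (t : Steps B R' ρ' R'' ρ'') : (s.append t).length = s.length + t.length := by
  induction s with
  | refl => simp [append, length]
  | head h s ih => simp only [append, length, ih]; omega

/-- A computation of `S₁; S₂` is one of `S₁` followed by one of `S₂`. -/
def splitSeq {S₁ S₂ : Prog ty} {ρ ρ'' : AllOp B} :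
    Steps B (some (.seq S₁ S₂)) ρ none ρ'' →
      Σ c : Computation B S₁ ρ, Steps B (some S₂) c.1 none ρ''
  | .head (.seq (S₁' := none) _ h) t => ⟨⟨_, .head h (.refl _ _)⟩, t⟩
  | .head (.seq (S₁' := some _) _ h) t => ⟨⟨_, .head h (splitSeq t).1.2⟩, (splitSeq t).2⟩
termination_by t => t.length
decreasing_by all_goals exact Nat.lt_succ_self _

/-- `splitSeq` recurses on length, so its equation lemmas replace definitional unfolding. The
intermediate state is part of its result, so the recursion is transported along an equality of
dependent pairs. -/
theorem splitSeq_append {S₂ : Prog ty} {ρ'' : AllOp B} : ∀ {S₁ : Prog ty} {ρ ρ' : AllOp B}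
    (s : Steps B (some S₁) ρ none ρ') (t : Steps B (some S₂) ρ' none ρ''),
    splitSeq ((s.liftSeq S₂).append t) = ⟨⟨ρ', s⟩, t⟩
  | _, _, _, .head (S' := none) h (.refl _ _), t => splitSeq.eq_1 _ h t
  | S₁, ρ, _, .head (S' := some _) h s, t =>
    (splitSeq.eq_2 _ _ h _).trans (congrArg
      (fun X : Σ c : Computation B _ _, Steps B (some S₂) c.1 none ρ'' =>
        (⟨⟨_, .head h X.1.2⟩, X.2⟩ : Σ c : Computation B S₁ ρ, Steps B (some S₂) c.1 none ρ''))
      (splitSeq_append s t))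

theorem append_splitSeq {S₂ : Prog ty} {ρ'' : AllOp B} : ∀ {S₁ : Prog ty} {ρ : AllOp B}
    (t : Steps B (some (.seq S₁ S₂)) ρ none ρ''),
    (t.splitSeq.1.2.liftSeq S₂).append t.splitSeq.2 = t
  | S₁, ρ, .head (.seq (S₁' := none) _ h) t =>
    congrArg (fun X : Σ c : Computation B S₁ ρ, Steps B (some S₂) c.1 none ρ'' =>
      (X.1.2.liftSeq S₂).append X.2) (splitSeq.eq_1 _ h t)
  | S₁, ρ, .head (.seq (S₁' := some _) _ h) t =>
    (congrArg (fun X : Σ c : Computation B S₁ ρ, Steps B (some S₂) c.1 none ρ'' =>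
      (X.1.2.liftSeq S₂).append X.2) (splitSeq.eq_2 _ _ h t)).trans
      (congrArg (Steps.head (.seq S₂ h)) (append_splitSeq t))
termination_by _ _ t => t.length
decreasing_by exact Nat.lt_succ_self _

end Steps

namespace Computation

/-- The computations of `S₁; S₂`. -/
def seqEquiv (S₁ S₂ : Prog ty) (ρ : AllOp B) :
    (Σ c : Computation B S₁ ρ, Computation B S₂ c.1) ≃ Computation B (.seq S₁ S₂) ρ where
  toFun p := ⟨p.2.1, (p.1.2.liftSeq S₂).append p.2.2⟩
  invFun c := ⟨c.2.splitSeq.1, ⟨c.1, c.2.splitSeq.2⟩⟩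
  left_inv := by
    rintro ⟨⟨ρ', s⟩, ⟨ρ'', t⟩⟩
    exact congrArg (fun X : Σ c : Computation B S₁ ρ, Steps B (some S₂) c.1 none ρ'' =>
      (⟨X.1, ⟨ρ'', X.2⟩⟩ : Σ c : Computation B S₁ ρ, Computation B S₂ c.1))
      (Steps.splitSeq_append s t)
  right_inv := by
    rintro ⟨ρ'', t⟩
    exact congrArg (Sigma.mk ρ'') (Steps.append_splitSeq t)

/-- The computations of `measure M[r] : (S_m)_m`. -/
def measureEquiv {n : ℕ} (r : Register Var n) {ι : Type} (M : Measurement ι (RegSpace ty r))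
    (S : ι → Prog ty) (ρ : AllOp B) :
    (Σ m, Computation B (S m) (conj (cyl B r (M.op m)) ρ)) ≃ Computation B (.measure r M S) ρ where
  toFun p := ⟨p.2.1, .head (.measure r M S ρ p.1) p.2.2⟩
  invFun
    | ⟨_, .head (.measure _ _ _ _ m) t⟩ => ⟨m, ⟨_, t⟩⟩
  left_inv _ := rfl
  right_inv := by
    rintro ⟨_, _ | ⟨⟨⟩, t⟩⟩
    rfl

/-- The computations of `while M[r] = 1 do S`: the loop is left at once, or the body is executed
and then the loop again. -/
def loopEquiv {n : ℕ} (r : Register Var n) (M : Measurement (Fin 2) (RegSpace ty r))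
    (S : Prog ty) (ρ : AllOp B) :
    Unit ⊕ Computation B (.seq S (.loop r M S)) (conj (cyl B r (M.op 1)) ρ) ≃
      Computation B (.loop r M S) ρ where
  toFun
    | .inl _ => ⟨_, .head (.loop0 r M S ρ) (.refl _ _)⟩
    | .inr c => ⟨c.1, .head (.loop1 r M S ρ) c.2⟩
  invFun
    | ⟨_, .head (.loop0 _ _ _ _) _⟩ => .inl ()
    | ⟨_, .head (.loop1 _ _ _ _) t⟩ => .inr ⟨_, t⟩
  left_inv := by rintro (_ | _) <;> rfl
  right_inv := by
    rintro ⟨_, _ | ⟨⟨⟩, t⟩⟩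
    · cases t
      rfl
    · rfl

/-- The only computation of `skip`. -/
def skipEquiv (ρ : AllOp B) : Unit ≃ Computation B .skip ρ where
  toFun _ := ⟨ρ, .head (.skip ρ) (.refl _ _)⟩
  invFun _ := ()
  left_inv _ := rfl
  right_inv := by
    rintro ⟨_, _ | ⟨⟨⟩, t⟩⟩
    cases t
    rfl

/-- The only computation of `q := 0`. -/
def initEquiv (q : Var) (ρ : AllOp B) : Unit ≃ Computation B (.init q) ρ where
  toFun _ := ⟨_, .head (.init q ρ) (.refl _ _)⟩
  invFun _ := ()
  left_inv _ := rfl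
  right_inv := by
    rintro ⟨_, _ | ⟨⟨⟩, t⟩⟩
    cases t
    rfl

/-- The only computation of `r := U r`. -/
def unitaryEquiv {n : ℕ} (r : Register Var n) (U : RegSpace ty r →L[ℂ] RegSpace ty r)
    (hU : ContinuousLinearMap.adjoint U ∘L U = ContinuousLinearMap.id ℂ (RegSpace ty r))
    (ρ : AllOp B) : Unit ≃ Computation B (.unitary r U hU) ρ where
  toFun _ := ⟨_, .head (.unitary r U hU ρ) (.refl _ _)⟩
  invFun _ := ()
  left_inv _ := rfl
  right_inv := by
    rintro ⟨_, _ | ⟨⟨⟩, t⟩⟩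
    cases t
    rfl

end Computation

end Computations

/-! ### Computations indexed by outcomes independent of the state -/

section Outcomes

variable {Var : Type} {ty : Var → QType}

/-- The sequences of measurement outcomes of the terminating computations of a program. -/
def Outcome : Prog ty → Type
  | .skip => Unit
  | .init _ => Unit
  | .unitary _ _ _ => Unit
  | .seq S₁ S₂ => Outcome S₁ × Outcome S₂
  | .measure _ _ S => Σ m, Outcome (S m)
  | .loop _ _ S => List (Outcome S)

/-- The final state of the computation with the given outcomes. -/
def eval (B : ProductBasis ty) : (S : Prog ty) → Outcome S → AllOp B → AllOp B
  | .skip, _, ρ => ρ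
  | .init q, _, ρ => initState B q ρ
  | .unitary r U _, _, ρ => conj (cyl B r U) ρ
  | .seq S₁ S₂, p, ρ => eval B S₂ p.2 (eval B S₁ p.1 ρ)
  | .measure r M S, p, ρ => eval B (S p.1) p.2 (conj (cyl B r (M.op p.1)) ρ)
  | .loop r M S, p, ρ =>
    listEval (conj (cyl B r (M.op 0))) (fun p σ => eval B S p (conj (cyl B r (M.op 1)) σ)) p ρ

variable {B : ProductBasis ty}

section Loop

variable {n : ℕ} {r : Register Var n} {M : Measurement (Fin 2) (RegSpace ty r)} {S : Prog ty}
  {P : Type}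

/-- The computation of a loop in which the body is executed with the given outcomes. -/
def loopComputation (e : (ρ : AllOp B) → P ≃ Computation B S ρ) :
    List P → (ρ : AllOp B) → Computation B (.loop r M S) ρ
  | [], ρ => Computation.loopEquiv r M S ρ (.inl ())
  | p :: l, ρ => Computation.loopEquiv r M S ρ (.inr (Computation.seqEquiv S _ _
      ⟨e _ p, loopComputation e l (e (conj (cyl B r (M.op 1)) ρ) p).1⟩))

theorem loopComputation_injective (e : (ρ : AllOp B) → P ≃ Computation B S ρ) (l : List P) :
    ∀ (l' : List P) (ρ : AllOp B), loopComputation (r := r) (M := M) e l ρ =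
      loopComputation e l' ρ → l = l' := by
  induction l with
  | nil =>
    rintro (_ | ⟨p', l'⟩) ρ h
    · rfl
    · exact absurd ((Computation.loopEquiv r M S ρ).injective h) Sum.inl_ne_inr
  | cons p l ih =>
    rintro (_ | ⟨p', l'⟩) ρ h
    · exact absurd ((Computation.loopEquiv r M S ρ).injective h) Sum.inr_ne_inl
    · have h' := (Computation.seqEquiv S (.loop r M S) _).injective
        (Sum.inr.inj ((Computation.loopEquiv r M S ρ).injective h))
      obtain rfl : p = p' := (e _).injective (congrArg Sigma.fst h')
      rw [ih l' _ (eq_of_heq (Sigma.mk.inj h').2)]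

/-- Induction on a length bound: the part after one pass through the body is again a computation of
the loop, and a shorter one. -/
theorem loopComputation_surjective (e : (ρ : AllOp B) → P ≃ Computation B S ρ) (N : ℕ) :
    ∀ (ρ : AllOp B) (c : Computation B (.loop r M S) ρ), c.2.length < N →
      ∃ l, loopComputation e l ρ = c := by
  induction N with
  | zero => exact fun _ _ h => absurd h (Nat.not_lt_zero _)
  | succ N ih =>
    intro ρ c hc
    obtain ⟨_ | d, rfl⟩ := (Computation.loopEquiv r M S ρ).surjective c
    · exact ⟨[], rfl⟩
    · obtain ⟨⟨c₁, c₂⟩, rfl⟩ := (Computation.seqEquiv S (.loop r M S) _).surjective d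
      obtain ⟨p, rfl⟩ := (e _).surjective c₁
      have hlt : c₂.2.length < N := by
        -- The initial loop transition accounts for the dropped successor; `c₂` is a final segment
        -- of what remains.
        refine lt_of_le_of_lt ?_ (Nat.lt_of_succ_lt_succ hc)
        exact (Nat.le_add_left _ _).trans_eq (Steps.length_append _ _).symm
      obtain ⟨l, rfl⟩ := ih _ c₂ hlt
      exact ⟨p :: l, rfl⟩

theorem loopComputation_fst {e : (ρ : AllOp B) → P ≃ Computation B S ρ}
    {Φ : P → AllOp B → AllOp B} (he : ∀ ρ p, (e ρ p).1 = Φ p ρ) (l : List P) :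
    ∀ ρ : AllOp B, (loopComputation (r := r) (M := M) e l ρ).1 =
      listEval (conj (cyl B r (M.op 0))) (fun p σ => Φ p (conj (cyl B r (M.op 1)) σ)) l ρ := by
  induction l with
  | nil => exact fun _ => rfl
  | cons p l ih =>
    intro ρ
    have h := ih (e (conj (cyl B r (M.op 1)) ρ) p).1
    rw [he] at h
    rw [listEval, ← h, ← he]
    rfl

end Loop

/-- No positivity is needed: branches that reach the zero operator are still counted as
computations. The equivalence for `S₂` is required at every state, since `S₁` may end anywhere. -/
theorem exists_outcomeEquiv (S : Prog ty) : ∀ ρ : AllOp B,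
    ∃ e : Outcome S ≃ Computation B S ρ, ∀ p, (e p).1 = eval B S p ρ := by
  induction S with
  | skip => exact fun ρ => ⟨Computation.skipEquiv ρ, fun _ => rfl⟩
  | init q => exact fun ρ => ⟨Computation.initEquiv q ρ, fun _ => rfl⟩
  | unitary r U hU => exact fun ρ => ⟨Computation.unitaryEquiv r U hU ρ, fun _ => rfl⟩
  | seq S₁ S₂ ih₁ ih₂ =>
    intro ρ
    obtain ⟨e₁, h₁⟩ := ih₁ ρ
    choose e₂ h₂ using ih₂
    refine ⟨((Equiv.sigmaEquivProd _ _).symm.trans (Equiv.sigmaCongr e₁ fun p => e₂ (e₁ p).1)).trans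
      (Computation.seqEquiv S₁ S₂ ρ), fun p => ?_⟩
    change (e₂ (e₁ p.1).1 p.2).1 = eval B S₂ p.2 (eval B S₁ p.1 ρ)
    rw [h₂, h₁]
  | measure r M S ih =>
    intro ρ
    choose e he using fun m => ih m (conj (cyl B r (M.op m)) ρ)
    exact ⟨(Equiv.sigmaCongrRight e).trans (Computation.measureEquiv r M S ρ),
      fun p => he p.1 p.2⟩
  | loop r M S ih =>
    intro ρ
    choose e he using ih
    exact ⟨Equiv.ofBijective (fun l => loopComputation e l ρ)
      ⟨fun l l' h => loopComputation_injective e l l' ρ h,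
        fun c => loopComputation_surjective e _ ρ c (Nat.lt_succ_self _)⟩,
      fun l => loopComputation_fst he l ρ⟩

theorem denote_eq_tsum_eval (S : Prog ty) (ρ : AllOp B) :
    denote B S ρ = ∑' p, eval B S p ρ := by
  obtain ⟨e, he⟩ := exists_outcomeEquiv S ρ
  simp only [denote, ← he]
  exact (e.tsum_eq fun c => c.1).symm

theorem summable_computation_iff (S : Prog ty) (ρ : AllOp B) :
    (Summable fun c : Computation B S ρ => c.1) ↔ Summable fun p => eval B S p ρ := by
  obtain ⟨e, he⟩ := exists_outcomeEquiv S ρ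
  rw [← e.summable_iff]
  simp only [Function.comp_def, he]

/-- Completeness of `M` splits the trace between the two outcomes, and the body does not increase
the share of outcome `1`. -/
theorem trace_loop_le {n : ℕ} (r : Register Var n) (M : Measurement (Fin 2) (RegSpace ty r))
    {P : Type} {Φ : P → AllOp B → AllOp B} (hΦ : IsInstrument Φ) (ρ : AllOp B) (hρ : 0 ≤ ρ)
    (ht : trace ρ ≠ ⊤) : trace (conj (cyl B r (M.op 0)) ρ) +
      ∑' p, trace (Φ p (conj (cyl B r (M.op 1)) ρ)) ≤ trace ρ := by
  have hM := isInstrument_measurement B r M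
  refine le_trans ?_ (hM.tsum_trace_le ρ hρ ht)
  rw [tsum_fintype (L := .unconditional (Fin 2)), Fin.sum_univ_two]
  exact add_le_add le_rfl
    (hΦ.tsum_trace_le _ (hM.nonneg ρ hρ ht 1) (hM.trace_ne_top hρ ht 1))

theorem isInstrument_loopBody {n : ℕ} (r : Register Var n)
    (M : Measurement (Fin 2) (RegSpace ty r)) {P : Type} {Φ : P → AllOp B → AllOp B}
    (hΦ : IsInstrument Φ) : IsInstrument fun p σ => Φ p (conj (cyl B r (M.op 1)) σ) :=
  (((isInstrument_measurement B r M).single 1).prod hΦ).reindex (Equiv.uniqueProd P Unit).symm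

theorem isInstrument_eval (S : Prog ty) : IsInstrument (eval B S) := by
  induction S with
  | skip => exact IsInstrument.id
  | init q => exact isOperation_initState B q
  | unitary r U hU => exact isOperation_unitary B r U hU
  | seq S₁ S₂ ih₁ ih₂ => exact ih₁.prod ih₂
  | measure r M S ih => exact (isInstrument_measurement B r M).sigma ih
  | loop r M S ih =>
    exact IsInstrument.listEval ((isInstrument_measurement B r M).single 0)
      (isInstrument_loopBody r M ih) (trace_loop_le r M ih)

theorem isOperation_denote (S : Prog ty) : IsOperation (denote B S) := by
  rw [show denote B S = _ from funext (denote_eq_tsum_eval S)]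
  exact (isInstrument_eval S).total

/-! ### Structural equations of the semantics -/

variable {ρ : AllOp B}

theorem tsum_unit {E : Type*} [AddCommMonoid E] [TopologicalSpace E] (x : E) :
    ∑' _ : Unit, x = x := by
  rw [tsum_fintype, Fintype.sum_unique]

theorem denote_skip (ρ : AllOp B) : denote B .skip ρ = ρ := by
  rw [denote_eq_tsum_eval]
  exact tsum_unit ρ

theorem denote_init (q : Var) (ρ : AllOp B) : denote B (.init q) ρ = initState B q ρ := by
  rw [denote_eq_tsum_eval]
  exact tsum_unit (initState B q ρ)

theorem denote_unitary {n : ℕ} (r : Register Var n) (U : RegSpace ty r →L[ℂ] RegSpace ty r)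
    (hU : ContinuousLinearMap.adjoint U ∘L U = ContinuousLinearMap.id ℂ (RegSpace ty r))
    (ρ : AllOp B) : denote B (.unitary r U hU) ρ = conj (cyl B r U) ρ := by
  rw [denote_eq_tsum_eval]
  exact tsum_unit (conj (cyl B r U) ρ)

theorem denote_seq (S₁ S₂ : Prog ty) (hρ : 0 ≤ ρ) (ht : trace ρ ≠ ⊤) :
    denote B (.seq S₁ S₂) ρ = denote B S₂ (denote B S₁ ρ) := by
  have h := isInstrument_eval (B := B) S₁
  rw [denote_eq_tsum_eval S₁, IsInstrument.map_tsum (isOperation_denote S₂) _ (h.nonneg ρ hρ ht)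
    (h.tsum_trace_ne_top hρ ht) (), denote_eq_tsum_eval]
  simp only [denote_eq_tsum_eval S₂]
  exact ((isInstrument_eval (.seq S₁ S₂)).summable hρ ht).tsum_prod

theorem hasSum_denote_measure {n : ℕ} (r : Register Var n) {ι : Type}
    (M : Measurement ι (RegSpace ty r)) (S : ι → Prog ty) (hρ : 0 ≤ ρ) (ht : trace ρ ≠ ⊤) :
    HasSum (fun m => denote B (S m) (conj (cyl B r (M.op m)) ρ)) (denote B (.measure r M S) ρ) := by
  rw [denote_eq_tsum_eval]
  have h := (isInstrument_eval (.measure r M S)).summable hρ ht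
  refine h.hasSum.sigma fun m => ?_
  rw [denote_eq_tsum_eval]
  exact (h.comp_injective (sigma_mk_injective (i := m))).hasSum

theorem hasSum_denote_loop {n : ℕ} (r : Register Var n) (M : Measurement (Fin 2) (RegSpace ty r))
    (S : Prog ty) (hρ : 0 ≤ ρ) (ht : trace ρ ≠ ⊤) :
    HasSum (fun k : ℕ => conj (cyl B r (M.op 0))
        ((fun σ => denote B S (conj (cyl B r (M.op 1)) σ))^[k] ρ))
      (denote B (.loop r M S) ρ) := by
  have h := isInstrument_eval (B := B) S
  have hs := hasSum_listEval_iterate ((isInstrument_measurement B r M).single 0)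
    (isInstrument_loopBody r M h) (trace_loop_le r M h) hρ ht
  simp only [denote_eq_tsum_eval]
  exact hs

/-- Reaching `Ω` contributes zero, so exactly the runs with fewer than `k` passes through the body
survive. -/
theorem denote_unfold {n : ℕ} (r : Register Var n) (M : Measurement (Fin 2) (RegSpace ty r))
    (S : Prog ty) {Ω : Prog ty} (hΩ : ∀ σ : AllOp B, IsPartialDensity σ → denote B Ω σ = 0)
    (k : ℕ) : ∀ {ρ : AllOp B}, IsPartialDensity ρ → denote B (unfold Ω r M S k) ρ =
      ∑ j ∈ Finset.range k, conj (cyl B r (M.op 0))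
        ((fun σ => denote B S (conj (cyl B r (M.op 1)) σ))^[j] ρ) := by
  induction k with
  | zero => exact fun hρ => hΩ _ hρ
  | succ k ih =>
    intro ρ hρ
    have hd := isPartialDensity_iff.1 hρ
    have ht := ne_top_of_le_ne_top ENNReal.one_ne_top hd.2
    have hM := (isInstrument_measurement B r M).single 1
    have hF := (isOperation_denote S).comp hM
    -- Outcome `0` gives the term `j = 0`; outcome `1` gives the sum for `k` at the state after one
    -- pass, which is the same sum with `j` shifted by one.
    rw [unfold, ← (hasSum_denote_measure r M _ hd.1 ht).tsum_eq, tsum_fintype, Fin.sum_univ_two,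
      Finset.sum_range_succ', add_comm]
    simp only [Matrix.cons_val_zero, Matrix.cons_val_one, denote_skip]
    rw [denote_seq _ _ (hM.nonneg hd.1 ht) (hM.trace_ne_top hd.1 ht ()),
      ih (hF.isPartialDensity hρ)]
    rfl

theorem isLUB_denote_unfold {n : ℕ} (r : Register Var n)
    (M : Measurement (Fin 2) (RegSpace ty r)) (S : Prog ty) {Ω : Prog ty}
    (hΩ : ∀ σ : AllOp B, IsPartialDensity σ → denote B Ω σ = 0) (hρ : IsPartialDensity ρ) :
    IsLUB (Set.range fun k => denote B (unfold Ω r M S k) ρ) (denote B (.loop r M S) ρ) := by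
  have hd := isPartialDensity_iff.1 hρ
  have ht := ne_top_of_le_ne_top ENNReal.one_ne_top hd.2
  have hM := isInstrument_measurement B r M
  have hF := (isOperation_denote S).comp (hM.single 1)
  simp only [denote_unfold r M S hΩ _ hρ]
  -- A norm limit of an increasing sequence is its least upper bound, the Löwner order being closed.
  refine isLUB_of_tendsto_atTop (monotone_nat_of_le_succ fun k => ?_)
    (hasSum_denote_loop r M S hd.1 ht).tendsto_sum_nat
  rw [Finset.sum_range_succ]
  exact le_add_of_nonneg_right (((hM.single 0).comp (hF.iterate k)).nonneg hd.1 ht)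

/-- Every term of the loop series ends with conjugation by the exit operator, here zero. -/
theorem denote_diverge (q : Var) (hρ : 0 ≤ ρ) (ht : trace ρ ≠ ⊤) :
    denote B (diverge ty q) ρ = 0 := by
  have h := hasSum_denote_loop (single q) Measurement.trivial .skip hρ ht
  have h0 : ∀ σ : AllOp B, conj (cyl B (single q) ((Measurement.trivial (H := _)).op 0)) σ = 0 :=
    fun σ => by
      change conj (cyl B (single q) 0) σ = 0
      rw [cyl_zero, conj, ContinuousLinearMap.zero_comp]
  simp only [h0] at h
  exact h.unique hasSum_zero

/-- `boolIdx` as an equivalence. -/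
def boolIdxEquiv {t : QType} (h : t = .boolean) : Fin 2 ≃ Idx t :=
  Equiv.cast (congrArg Idx h.symm)

/-- `intIdx` as an equivalence. -/
def intIdxEquiv {t : QType} (h : t = .integer) : ℤ ≃ Idx t :=
  Equiv.cast (congrArg Idx h.symm)

theorem zeroIdx_eq_boolIdx {t : QType} (h : t = .boolean) : zeroIdx t = boolIdx h 0 := by
  subst h
  rfl

theorem zeroIdx_eq_intIdx {t : QType} (h : t = .integer) : zeroIdx t = intIdx h 0 := by
  subst h
  rfl

theorem hasSum_denote_init (q : Var) (hρ : 0 ≤ ρ) (ht : trace ρ ≠ ⊤) :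
    HasSum (fun k => ketbraAt B q (zeroIdx (ty q)) k ∘L ρ ∘L ketbraAt B q k (zeroIdx (ty q)))
      (denote B (.init q) ρ) := by
  rw [denote_init, initState_eq_tsum]
  simp only [← conj_ketbraAt]
  exact ((isInstrument_ketbraAt B q).summable hρ ht).hasSum

end Outcomes

end

end QWhile

open QWhile
theorem mainTheorem9 {Var : Type} [Countable Var] [Infinite Var] (ty : Var → QType)
    (B : ProductBasis ty) :
    -- the multiset sums converge and define a map on partial density operators
    (∀ (S : Prog ty) (ρ : AllOp B), IsPartialDensity ρ →
      Summable (fun c : Computation B S ρ => c.1) ∧ IsPartialDensity (denote B S ρ)) ∧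
    ∀ ρ : AllOp B, IsPartialDensity ρ →
      -- skip
      denote B .skip ρ = ρ ∧
      -- initialisation
      (∀ (q : Var) (h : ty q = .boolean),
        denote B (.init q) ρ =
          ketbraAt B q (boolIdx h 0) (boolIdx h 0) ∘L ρ ∘L
              ketbraAt B q (boolIdx h 0) (boolIdx h 0) +
            ketbraAt B q (boolIdx h 0) (boolIdx h 1) ∘L ρ ∘L
              ketbraAt B q (boolIdx h 1) (boolIdx h 0)) ∧
      (∀ (q : Var) (h : ty q = .integer),
        HasSum (fun k : ℤ => ketbraAt B q (intIdx h 0) (intIdx h k) ∘L ρ ∘L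
            ketbraAt B q (intIdx h k) (intIdx h 0))
          (denote B (.init q) ρ)) ∧
      -- unitary transformation
      (∀ (n : ℕ) (r : Register Var n) (U : RegSpace ty r →L[ℂ] RegSpace ty r)
        (hU : ContinuousLinearMap.adjoint U ∘L U = ContinuousLinearMap.id ℂ (RegSpace ty r)),
        denote B (.unitary r U hU) ρ = conj (cyl B r U) ρ) ∧
      -- sequential composition
      (∀ S₁ S₂ : Prog ty, denote B (.seq S₁ S₂) ρ = denote B S₂ (denote B S₁ ρ)) ∧
      -- measurement
      (∀ (n : ℕ) (r : Register Var n) (ι : Type) (M : Measurement ι (RegSpace ty r))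
        (S : ι → Prog ty),
        HasSum (fun m => denote B (S m) (conj (cyl B r (M.op m)) ρ))
          (denote B (.measure r M S) ρ)) ∧
      -- loop: supremum of the finite unfoldings, and the series
      (∀ (n : ℕ) (r : Register Var n) (M : Measurement (Fin 2) (RegSpace ty r)) (S : Prog ty),
        (∀ Ω : Prog ty, (∀ σ : AllOp B, IsPartialDensity σ → denote B Ω σ = 0) →
          IsLUB (Set.range fun k => denote B (unfold Ω r M S k) ρ) (denote B (.loop r M S) ρ)) ∧
        HasSum (fun k : ℕ => conj (cyl B r (M.op 0))
            ((fun σ => denote B S (conj (cyl B r (M.op 1)) σ))^[k] ρ))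
          (denote B (.loop r M S) ρ)) ∧
      -- the program `while M_trivial[q] = 1 do skip` may be taken for `Ω`
      (∀ q : Var, denote B (diverge ty q) ρ = 0) := by
  refine ⟨fun S ρ hρ => ?_, fun ρ hρ => ?_⟩
  · have hd := isPartialDensity_iff.1 hρ
    exact ⟨(summable_computation_iff S ρ).2 ((isInstrument_eval S).summable hd.1
      (ne_top_of_le_ne_top ENNReal.one_ne_top hd.2)), (isOperation_denote S).isPartialDensity hρ⟩
  obtain ⟨h0, h1⟩ := isPartialDensity_iff.1 hρ
  have ht := ne_top_of_le_ne_top ENNReal.one_ne_top h1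
  refine ⟨denote_skip ρ, fun q h => ?_, fun q h => ?_, fun n r U hU => denote_unitary r U hU ρ,
    fun S₁ S₂ => denote_seq S₁ S₂ h0 ht, fun n r ι M S => hasSum_denote_measure r M S h0 ht,
    fun n r M S => ⟨fun Ω hΩ => isLUB_denote_unfold r M S hΩ hρ, hasSum_denote_loop r M S h0 ht⟩,
    fun q => denote_diverge q h0 ht⟩
  · have hs := (boolIdxEquiv h).hasSum_iff.2 (hasSum_denote_init q h0 ht)
    rw [← hs.tsum_eq, tsum_fintype, Fin.sum_univ_two, zeroIdx_eq_boolIdx h]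
    rfl
  · have hs := (intIdxEquiv h).hasSum_iff.2 (hasSum_denote_init q h0 ht)
    rwa [zeroIdx_eq_intIdx h] at hs
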